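/- Let $a$ be a nonzero integer. Let $C_a$ be the smooth projective genus $3$ hyperelliptic curve over $\mathbb{Q}$ given by $$y^2 = x^8 + (4-4a^4)x^6 + (8a^4+6)x^4 + (4-4a^4)x^2 + 1,$$ with homogeneous coordinates $[x:y:z]$ of weights $1,4,1$ (so $C_a$ has two points $[1:\pm1:0]$ at infinity), and let $E_a$ be the elliptic curve $y^2 = x^3 + 2a^2x^2 + (a^4-4)x$ over $\mathbb{Q}$. Let $\varphi_1,\varphi_2\colon C_a\to E_a$ be the maps $$\begin{aligned} \varphi_1 = [\,&-a^2x^6+5a^2x^4z^2-2x^2y+5a^2x^2z^4-2yz^2-a^2z^6 :\\ & 4a^3x^5z-24a^3x^3z^3+8axyz+4a^3xz^5 : (x^2+z^2)^3\,],\\ \varphi_2 = [\,& a^2x^6-5a^2x^4z^2-2x^2y-5a^2x^2z^4-2yz^2+a^2z^6 :\\ & -2a^3x^6+14a^3x^4z^2+4ax^2y-14a^3x^2z^4-4ayz^2+2a^3z^6 : (x^2+z^2)^3\,]. \end{aligned}$$ For $Q\in E_a(\mathbb{Q})$ let $h(Q)$ be the logarithmic height of the $x$-coordinate of $Q$ (that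 is, $h(Q)=\log\max\{|r|,|s|\}$ if $x(Q)=r/s$ in lowest terms, and $h(\mathcal{O})=0$), and let $\hat h_{E_a}(Q)=\lim_{n\to\infty}4^{-n}h(2^nQ)$ be the canonical height. Then for every $P\in C_a(\mathbb{Q})$, $$\left|\hat h_{E_a}(\varphi_1(P))-\hat h_{E_a}(\varphi_2(P))\right|\le 51.18+2\log|a|.$$ -/

import Mathlib

open Filter Topology

namespace DemyanenkoManin

noncomputable section

/-! ### The hyperelliptic curve `C_a` -/

/-- The binary octic form whose dehomogenisation is
`x⁸ + (4 - 4a⁴) x⁶ + (8a⁴ + 6) x⁴ + (4 - 4a⁴) x² + 1`. -/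
def octic (a : ℤ) (X Z : ℚ) : ℚ :=
  X ^ 8 + (4 - 4 * (a : ℚ) ^ 4) * X ^ 6 * Z ^ 2 + (8 * (a : ℚ) ^ 4 + 6) * X ^ 4 * Z ^ 4
    + (4 - 4 * (a : ℚ) ^ 4) * X ^ 2 * Z ^ 6 + Z ^ 8

/-- Weighted homogeneous coordinates (of weights `1, 4, 1`) of rational points of the smooth
projective model `Y² = X⁸ + (4 - 4a⁴) X⁶ Z² + (8a⁴ + 6) X⁴ Z⁴ + (4 - 4a⁴) X² Z⁶ + Z⁸` of `C_a`.
When `X = Z = 0` the equation forces `Y = 0`, so `(X, Z) ≠ (0, 0)` is the condition that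
not all coordinates vanish. -/
@[ext]
structure CurveCoords (a : ℤ) where
  X : ℚ
  Y : ℚ
  Z : ℚ
  ne_zero : X ≠ 0 ∨ Z ≠ 0
  equation : Y ^ 2 = octic a X Z

/-- Two coordinate triples represent the same point of `ℙ(1, 4, 1)` iff they differ by the
weighted action `(X, Y, Z) ↦ (tX, t⁴Y, tZ)` of a nonzero scalar `t`. -/
instance curveSetoid (a : ℤ) : Setoid (CurveCoords a) where
  r p q := ∃ t : ℚ, t ≠ 0 ∧ q.X = t * p.X ∧ q.Y = t ^ 4 * p.Y ∧ q.Z = t * p.Z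
  iseqv :=
    { refl := fun p => ⟨1, one_ne_zero, by simp, by simp, by simp⟩
      symm := by
        rintro p q ⟨t, ht, h1, h2, h3⟩
        exact ⟨t⁻¹, inv_ne_zero ht, by rw [h1]; field_simp, by rw [h2]; field_simp,
          by rw [h3]; field_simp⟩
      trans := by
        rintro p q r ⟨t, ht, h1, h2, h3⟩ ⟨s, hs, k1, k2, k3⟩
        exact ⟨s * t, mul_ne_zero hs ht, by rw [k1, h1]; ring, by rw [k2, h2]; ring,
          by rw [k3, h3]; ring⟩ }

/-- The set `C_a(ℚ)` of rational points of the smooth projective curve `C_a`, including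
the two points `(1 : ±1 : 0)` at infinity. -/
def Curve (a : ℤ) : Type := Quotient (curveSetoid a)

/-! ### The elliptic curve `E_a` -/

/-- `E_a : y² = x³ + 2a² x² + (a⁴ - 4) x` over `ℚ`. -/
def E (a : ℤ) : WeierstrassCurve.Affine ℚ where
  a₁ := 0
  a₂ := 2 * (a : ℚ) ^ 2
  a₃ := 0
  a₄ := (a : ℚ) ^ 4 - 4
  a₆ := 0

theorem four_ne (a : ℤ) : (a : ℚ) ^ 4 - 4 ≠ 0 := by
  intro h
  have h1 : (a ^ 2 - 2) * (a ^ 2 + 2) = 0 := by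
    have : (((a ^ 2 - 2) * (a ^ 2 + 2) : ℤ) : ℚ) = 0 := by push_cast; linarith
    exact_mod_cast this
  have h2 : a ^ 2 = 2 := by
    rcases mul_eq_zero.mp h1 with h | h
    · linarith
    · nlinarith [sq_nonneg a]
  have h3 : a < 2 := by nlinarith
  have h4 : -2 < a := by nlinarith
  interval_cases a <;> omega

instance (a : ℤ) : (E a).IsElliptic := by
  rw [WeierstrassCurve.isElliptic_iff, isUnit_iff_ne_zero]
  have : (E a).Δ = 256 * ((a : ℚ) ^ 4 - 4) ^ 2 := by
    simp only [WeierstrassCurve.Δ, WeierstrassCurve.b₂, WeierstrassCurve.b₄, WeierstrassCurve.b₆,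
      WeierstrassCurve.b₈, E]
    ring
  rw [this]
  exact mul_ne_zero (by norm_num) (pow_ne_zero 2 (four_ne a))

/-! ### The two maps `φ₁, φ₂ : C_a → E_a` -/

/-- The first homogeneous coordinate of the first map `φ₁ = [phi1X : phi1Y : phiZ]`. -/
def phi1X (a : ℤ) (x y z : ℚ) : ℚ :=
  -(a : ℚ) ^ 2 * x ^ 6 + 5 * (a : ℚ) ^ 2 * x ^ 4 * z ^ 2 - 2 * x ^ 2 * y
    + 5 * (a : ℚ) ^ 2 * x ^ 2 * z ^ 4 - 2 * y * z ^ 2 - (a : ℚ) ^ 2 * z ^ 6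

/-- The second homogeneous coordinate of `φ₁`. -/
def phi1Y (a : ℤ) (x y z : ℚ) : ℚ :=
  4 * (a : ℚ) ^ 3 * x ^ 5 * z - 24 * (a : ℚ) ^ 3 * x ^ 3 * z ^ 3 + 8 * (a : ℚ) * x * y * z
    + 4 * (a : ℚ) ^ 3 * x * z ^ 5

/-- The first homogeneous coordinate of the second map `φ₂ = [phi2X : phi2Y : phiZ]`. -/
def phi2X (a : ℤ) (x y z : ℚ) : ℚ :=
  (a : ℚ) ^ 2 * x ^ 6 - 5 * (a : ℚ) ^ 2 * x ^ 4 * z ^ 2 - 2 * x ^ 2 * y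
    - 5 * (a : ℚ) ^ 2 * x ^ 2 * z ^ 4 - 2 * y * z ^ 2 + (a : ℚ) ^ 2 * z ^ 6

/-- The second homogeneous coordinate of `φ₂`. -/
def phi2Y (a : ℤ) (x y z : ℚ) : ℚ :=
  -2 * (a : ℚ) ^ 3 * x ^ 6 + 14 * (a : ℚ) ^ 3 * x ^ 4 * z ^ 2 + 4 * (a : ℚ) * x ^ 2 * y
    - 14 * (a : ℚ) ^ 3 * x ^ 2 * z ^ 4 - 4 * (a : ℚ) * y * z ^ 2 + 2 * (a : ℚ) ^ 3 * z ^ 6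

/-- The common last homogeneous coordinate of the two maps; it equals `(x² + z²)³` and so does
not vanish at rational points. -/
def phiZ (x z : ℚ) : ℚ := x ^ 6 + 3 * x ^ 4 * z ^ 2 + 3 * x ^ 2 * z ^ 4 + z ^ 6

theorem phiZ_eq (x z : ℚ) : phiZ x z = (x ^ 2 + z ^ 2) ^ 3 := by
  unfold phiZ; ring

theorem sq_add_sq_ne {a : ℤ} (p : CurveCoords a) : p.X ^ 2 + p.Z ^ 2 ≠ 0 := by
  rcases p.ne_zero with h | h <;> positivity

theorem phiZ_ne {a : ℤ} (p : CurveCoords a) : phiZ p.X p.Z ≠ 0 := by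
  rw [phiZ_eq]; exact pow_ne_zero 3 (sq_add_sq_ne p)

theorem phi1_equation {a : ℤ} (p : CurveCoords a) :
    (E a).Equation (phi1X a p.X p.Y p.Z / phiZ p.X p.Z) (phi1Y a p.X p.Y p.Z / phiZ p.X p.Z) := by
  have h := p.equation
  have hd := sq_add_sq_ne p
  rw [WeierstrassCurve.Affine.equation_iff, phiZ_eq]
  simp only [E]
  unfold octic at h
  rw [show phi1X a p.X p.Y p.Z = (p.X ^ 2 + p.Z ^ 2) * (-(a : ℚ) ^ 2 * p.X ^ 4 + 6 * a ^ 2 * p.X ^ 2 * p.Z ^ 2 - 2 * p.Y - a ^ 2 * p.Z ^ 4) by unfold phi1X; ring,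
    show phi1Y a p.X p.Y p.Z = (-4 * a * p.X * p.Z) * (-(a : ℚ) ^ 2 * p.X ^ 4 + 6 * a ^ 2 * p.X ^ 2 * p.Z ^ 2 - 2 * p.Y - a ^ 2 * p.Z ^ 4) by
      unfold phi1Y; ring]
  set A : ℚ := -(a : ℚ) ^ 2 * p.X ^ 4 + 6 * a ^ 2 * p.X ^ 2 * p.Z ^ 2 - 2 * p.Y - a ^ 2 * p.Z ^ 4 with hA
  have key : A * (16 * a ^ 2 * p.X ^ 2 * p.Z ^ 2 * A) = A * (A ^ 2
      + 2 * a ^ 2 * (p.X ^ 2 + p.Z ^ 2) ^ 2 * A + (a ^ 4 - 4) * (p.X ^ 2 + p.Z ^ 2) ^ 4) := by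
    congr 1
    rw [hA]
    linear_combination (-4) * h
  clear_value A
  field_simp
  linear_combination key

theorem phi2_equation {a : ℤ} (p : CurveCoords a) :
    (E a).Equation (phi2X a p.X p.Y p.Z / phiZ p.X p.Z) (phi2Y a p.X p.Y p.Z / phiZ p.X p.Z) := by
  have h := p.equation
  have hd := sq_add_sq_ne p
  rw [WeierstrassCurve.Affine.equation_iff, phiZ_eq]
  simp only [E]
  unfold octic at h
  rw [show phi2X a p.X p.Y p.Z = (p.X ^ 2 + p.Z ^ 2) * ((a : ℚ) ^ 2 * p.X ^ 4 - 6 * a ^ 2 * p.X ^ 2 * p.Z ^ 2 - 2 * p.Y + a ^ 2 * p.Z ^ 4) by unfold phi2X; ring,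
    show phi2Y a p.X p.Y p.Z = (-2 * a * (p.X ^ 2 - p.Z ^ 2)) * ((a : ℚ) ^ 2 * p.X ^ 4 - 6 * a ^ 2 * p.X ^ 2 * p.Z ^ 2 - 2 * p.Y + a ^ 2 * p.Z ^ 4) by
      unfold phi2Y; ring]
  set A : ℚ := (a : ℚ) ^ 2 * p.X ^ 4 - 6 * a ^ 2 * p.X ^ 2 * p.Z ^ 2 - 2 * p.Y + a ^ 2 * p.Z ^ 4 with hA
  have key : A * (4 * a ^ 2 * (p.X ^ 2 - p.Z ^ 2) ^ 2 * A) = A * (A ^ 2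
      + 2 * a ^ 2 * (p.X ^ 2 + p.Z ^ 2) ^ 2 * A + (a ^ 4 - 4) * (p.X ^ 2 + p.Z ^ 2) ^ 4) := by
    congr 1
    rw [hA]
    linear_combination (-4) * h
  clear_value A
  field_simp
  linear_combination key

/-- The map `φ₁` on coordinate triples. -/
def phi1Coords {a : ℤ} (p : CurveCoords a) : (E a).Point :=
  .some (phi1X a p.X p.Y p.Z / phiZ p.X p.Z) (phi1Y a p.X p.Y p.Z / phiZ p.X p.Z)
    (WeierstrassCurve.Affine.equation_iff_nonsingular.mp (phi1_equation p))

/-- The map `φ₂` on coordinate triples. -/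
def phi2Coords {a : ℤ} (p : CurveCoords a) : (E a).Point :=
  .some (phi2X a p.X p.Y p.Z / phiZ p.X p.Z) (phi2Y a p.X p.Y p.Z / phiZ p.X p.Z)
    (WeierstrassCurve.Affine.equation_iff_nonsingular.mp (phi2_equation p))

/-- The map `φ₁ : C_a(ℚ) → E_a(ℚ)`. -/
def phi1 {a : ℤ} (P : Curve a) : (E a).Point :=
  Quotient.lift (s := curveSetoid a) phi1Coords (by
    rintro p q ⟨t, ht, h1, h2, h3⟩
    have hp := phiZ_ne p
    have e : phiZ q.X q.Z = t ^ 6 * phiZ p.X p.Z := by rw [h1, h3]; unfold phiZ; ring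
    have e1 : phi1X a q.X q.Y q.Z = t ^ 6 * phi1X a p.X p.Y p.Z := by
      rw [h1, h2, h3]; unfold phi1X; ring
    have e2 : phi1Y a q.X q.Y q.Z = t ^ 6 * phi1Y a p.X p.Y p.Z := by
      rw [h1, h2, h3]; unfold phi1Y; ring
    simp only [phi1Coords, WeierstrassCurve.Affine.Point.some.injEq]
    rw [e, e1, e2]
    constructor <;> field_simp) P

/-- The map `φ₂ : C_a(ℚ) → E_a(ℚ)`. -/
def phi2 {a : ℤ} (P : Curve a) : (E a).Point :=
  Quotient.lift (s := curveSetoid a) phi2Coords (by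
    rintro p q ⟨t, ht, h1, h2, h3⟩
    have hp := phiZ_ne p
    have e : phiZ q.X q.Z = t ^ 6 * phiZ p.X p.Z := by rw [h1, h3]; unfold phiZ; ring
    have e1 : phi2X a q.X q.Y q.Z = t ^ 6 * phi2X a p.X p.Y p.Z := by
      rw [h1, h2, h3]; unfold phi2X; ring
    have e2 : phi2Y a q.X q.Y q.Z = t ^ 6 * phi2Y a p.X p.Y p.Z := by
      rw [h1, h2, h3]; unfold phi2Y; ring
    simp only [phi2Coords, WeierstrassCurve.Affine.Point.some.injEq]
    rw [e, e1, e2]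
    constructor <;> field_simp) P

/-! ### Heights on an elliptic curve over `ℚ` -/

/-- The naive height `h(P) = h(x(P))`: the logarithmic Weil height of the `x`-coordinate, with
`h(𝓞) = 0`, as `x(𝓞) = [1 : 0]`. For a fraction `r / s` in lowest terms this is
`log (max |r| |s|)`. -/
def naiveHeight {W : WeierstrassCurve.Affine ℚ} : W.Point → ℝ
  | .zero => 0
  | .some x _ _ => Height.logHeight₁ x

/-- The canonical (Néron–Tate) height `ĥ(P) = lim_{n → ∞} 4⁻ⁿ h(2ⁿ P)`, normalised so that
`ĥ - h` is bounded for the naive height `h` of the `x`-coordinate. -/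
def canonicalHeight {W : WeierstrassCurve.Affine ℚ} (P : W.Point) : ℝ :=
  limUnder atTop fun n : ℕ => naiveHeight ((2 ^ n : ℕ) • P) / (4 : ℝ) ^ n

/-! The limit defining the canonical height exists for every point of `E_a`. -/

/-- The binary form of degree `N` with coefficients `c`. -/
def binForm (N : ℕ) (c : Fin (N + 1) → ℚ) : MvPolynomial (Fin 2) ℚ :=
  ∑ i : Fin (N + 1), MvPolynomial.C (c i) * (MvPolynomial.X 0 ^ (i : ℕ) *
    MvPolynomial.X 1 ^ (N - (i : ℕ)))

theorem binForm_homogeneous (N : ℕ) (c : Fin (N + 1) → ℚ) : (binForm N c).IsHomogeneous N := by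
  refine MvPolynomial.IsHomogeneous.sum _ _ _ fun i _ => ?_
  have h := (MvPolynomial.isHomogeneous_C (Fin 2) (c i)).mul
    (((MvPolynomial.isHomogeneous_X ℚ (0 : Fin 2)).pow (i : ℕ)).mul
      ((MvPolynomial.isHomogeneous_X ℚ (1 : Fin 2)).pow (N - (i : ℕ))))
  convert h using 1
  have := i.is_lt
  omega

/-- Numerator and denominator of the duplication formula for the `x`-coordinate. -/
def dupl (b c : ℚ) : Fin 2 → MvPolynomial (Fin 2) ℚ :=
  ![binForm 4 ![b ^ 2, 0, -2 * b, 0, 1], binForm 4 ![0, 4 * b, 4 * c, 4, 0]]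

theorem naiveHeight_two_smul (a : ℤ) :
    ∃ C : ℝ, ∀ P : (E a).Point, |naiveHeight (2 • P) - 4 * naiveHeight P| ≤ C := by
  set b : ℚ := (a : ℚ) ^ 4 - 4 with hb
  set c : ℚ := 2 * (a : ℚ) ^ 2 with hc
  have hb0 : b ≠ 0 := four_ne a
  have hcb : c ^ 2 = 4 * b + 16 := by rw [hb, hc]; ring
  obtain ⟨C₁, h₁⟩ := Height.logHeight_eval_le' (K := ℚ) (N := 4) (p := dupl b c)
    (by intro i; fin_cases i <;> exact binForm_homogeneous _ _)
  let q : Fin 2 × Fin 2 → MvPolynomial (Fin 2) ℚ := fun kj =>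
    (![![binForm 3 ![0, -12 * b ^ 2 / 64, -8 * b * c / 64, 1],
        binForm 3 ![3 * b ^ 3 / 64, - b ^ 2 * c / 64, -5 * b ^ 2 / 64, 2 * b * c / 64]],
      ![binForm 3 ![64 / (64 * b ^ 2), -8 * c / (64 * b ^ 2), -12 / (64 * b ^ 2), 0],
        binForm 3 ![2 * b * c / (64 * b ^ 2), -5 * b / (64 * b ^ 2), - c / (64 * b ^ 2),
          3 / (64 * b ^ 2)]]] : Fin 2 → Fin 2 → MvPolynomial (Fin 2) ℚ) kj.1 kj.2
  obtain ⟨C₂, h₂⟩ := Height.logHeight_eval_ge' (K := ℚ) (M := 3) (N := 4) (q := q)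
    (by rintro ⟨i, j⟩; fin_cases i <;> fin_cases j <;> exact binForm_homogeneous _ _)
  have key : ∀ x : ℚ, |Height.logHeight ![(x ^ 2 - b) ^ 2, 4 * (x * (x ^ 2 + c * x + b))]
      - 4 * Height.logHeight₁ x| ≤ max C₁ (-C₂) := by
    intro x
    have hv : (fun j => (dupl b c j).eval ![x, 1]) =
        ![(x ^ 2 - b) ^ 2, 4 * (x * (x ^ 2 + c * x + b))] := by
      funext j
      fin_cases j <;> simp [dupl, binForm, Fin.sum_univ_succ] <;> ring
    have u₁ := h₁ ![x, 1]
    have u₂ := h₂ (dupl b c) (x := ![x, 1]) (by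
      intro k
      fin_cases k
      · simp [q, dupl, binForm, Fin.sum_univ_succ]
        linear_combination (-b ^ 2 / 16 * x ^ 3 + b / 8 * x ^ 5) * hcb
      · simp [q, dupl, binForm, Fin.sum_univ_succ]
        field_simp
        linear_combination (8 * b * x ^ 2 - 4 * x ^ 4) * hcb)
    rw [hv, ← Height.logHeight₁_eq_logHeight] at u₁ u₂
    push_cast at u₁ u₂
    rw [abs_sub_le_iff]
    exact ⟨by linarith [le_max_left C₁ (-C₂)], by linarith [le_max_right C₁ (-C₂)]⟩
  refine ⟨max 0 (max C₁ (-C₂)), ?_⟩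
  rintro (_ | ⟨x, y, h⟩)
  · have : (2 • (WeierstrassCurve.Affine.Point.zero : (E a).Point)) = .zero :=
      smul_zero (A := (E a).Point) 2
    rw [this]; simp [naiveHeight]
  · refine le_trans ?_ ((key x).trans (le_max_right _ _))
    have heq : y ^ 2 = x * (x ^ 2 + c * x + b) := by
      have := (WeierstrassCurve.Affine.equation_iff ..).mp h.1
      simp only [E] at this
      rw [hb, hc]; linarith
    rw [← heq, ← Height.logHeight₁_div_eq_logHeight]
    apply le_of_eq
    congr 2
    rw [two_smul]
    by_cases hy : y = 0
    · rw [WeierstrassCurve.Affine.Point.add_self_of_Y_eq (by simp [E, hy])]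
      subst hy
      simp only [ne_eq, OfNat.ofNat_ne_zero, not_false_eq_true, zero_pow, mul_zero, div_zero,
        Height.logHeight₁_zero]
      rfl
    · have hne : y ≠ (E a).negY x y := by
        simp only [WeierstrassCurve.Affine.negY, E]
        intro h'
        exact hy (by linarith)
      rw [WeierstrassCurve.Affine.Point.add_self_of_Y_ne hne]
      simp only [naiveHeight]
      congr 1
      rw [WeierstrassCurve.Affine.slope_of_Y_ne rfl hne]
      simp only [WeierstrassCurve.Affine.addX, WeierstrassCurve.Affine.negY, E]
      rw [← hb, ← hc]
      have : y - (-y - 0 * x - 0) = 2 * y := by ring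
      rw [this]
      field_simp
      linear_combination (-16 * c - 32 * x) * heq

theorem tendsto_canonicalHeight {a : ℤ} (P : (E a).Point) :
    Tendsto (fun n : ℕ => naiveHeight ((2 ^ n : ℕ) • P) / (4 : ℝ) ^ n) atTop
      (𝓝 (canonicalHeight P)) := by
  obtain ⟨C, hC⟩ := naiveHeight_two_smul a
  refine CauchySeq.tendsto_limUnder ?_
  refine cauchySeq_of_le_geometric (1 / 4) (C / 4) (by norm_num) fun n => ?_
  have h := hC ((2 ^ n : ℕ) • P)
  rw [smul_smul, ← pow_succ'] at h
  rw [dist_comm, Real.dist_eq]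
  have e : naiveHeight ((2 ^ (n + 1) : ℕ) • P) / (4 : ℝ) ^ (n + 1)
      - naiveHeight ((2 ^ n : ℕ) • P) / (4 : ℝ) ^ n
      = (naiveHeight ((2 ^ (n + 1) : ℕ) • P) - 4 * naiveHeight ((2 ^ n : ℕ) • P))
        / (4 : ℝ) ^ (n + 1) := by
    rw [pow_succ (4 : ℝ)]; field_simp
  rw [e, abs_div, abs_of_pos (by positivity : (0 : ℝ) < 4 ^ (n + 1))]
  calc _ ≤ C / 4 ^ (n + 1) := by gcongr
    _ = C / 4 * (1 / 4) ^ n := by rw [pow_succ, one_div, inv_pow]; field_simp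

end

end DemyanenkoManin

open Filter Topology

namespace DemyanenkoManin

/-! Write b = a⁴ - 4, so E_a is y² = x(x² + 2a²x + b). The x-coordinates of φ₁(P) and φ₂(P) have
product -b (`phi1X_mul_phi2X`). Hence their images under the 2-isogeny coordinate X = y²/(4x²) = (x
+ 2a² + b/x)/4 sum to a². Both are squares, so they lie in [0, a²].

The x-coordinate of the double is (X² - a²X + 1)/X. With X = n/m in lowest terms this is [m² - n(a²m
- n) : mn], again in lowest terms. Replacing n by a²m - n keeps the first entry and changes the
second in a controlled way, so the heights of the two doubled points are close
(`scaledHeight_two_smul_le`).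

To pass to canonical heights, `scaledHeight` weights the denominator by a², the size of the roots of
the cubic. Its defect under doubling is bounded by a Bézout argument for the content and a real
estimate valid for x ≥ 0, which holds for every doubled point. Telescoping gives
`canonicalHeight_sub_scaledHeight`; applying it to 2φ₁(P) and 2φ₂(P) and dividing by 4 finishes the
proof. -/

/-! ### Integral x-coordinates and the duplication formula. -/

/-- The numerator of the `x`-coordinate, with `x(𝓞) = [1 : 0]`. -/
def xNum {W : WeierstrassCurve.Affine ℚ} : W.Point → ℤ
  | .zero => 1
  | .some x _ _ => x.num

/-- The denominator of the `x`-coordinate, with `x(𝓞) = [1 : 0]`. -/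
def xDen {W : WeierstrassCurve.Affine ℚ} : W.Point → ℤ
  | .zero => 0
  | .some x _ _ => x.den

/-- The `x`-coordinate of the point is `[F : G]`. -/
def HasXCoord {W : WeierstrassCurve.Affine ℚ} (F G : ℤ) : W.Point → Prop
  | .zero => F ≠ 0 ∧ G = 0
  | .some x _ _ => G ≠ 0 ∧ x = F / G

theorem isCoprime_xNum_xDen {W : WeierstrassCurve.Affine ℚ} (P : W.Point) :
    IsCoprime (xNum P) (xDen P) := by
  rcases P with _ | ⟨x, y, h⟩
  · exact isCoprime_one_left
  · exact Rat.isCoprime_num_den x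

theorem xDen_nonneg {W : WeierstrassCurve.Affine ℚ} (P : W.Point) : 0 ≤ xDen P := by
  rcases P with _ | ⟨x, y, h⟩
  · exact le_rfl
  · exact Int.natCast_nonneg _

/-- The factor `k` is the content of the pair, up to sign; it is the only non-archimedean loss in
the height estimates. -/
theorem HasXCoord.exists_scale {W : WeierstrassCurve.Affine ℚ} {F G : ℤ} {P : W.Point}
    (h : HasXCoord F G P) : ∃ k : ℤ, k ≠ 0 ∧ F = k * xNum P ∧ G = k * xDen P := by
  rcases P with _ | ⟨x, y, hP⟩
  · exact ⟨F, h.1, (mul_one F).symm, by rw [h.2]; exact (mul_zero F).symm⟩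
  · obtain ⟨hG, hx⟩ := h
    obtain ⟨k, h1, h2⟩ := Rat.exists_eq_mul_div_num_and_eq_mul_div_den F hG
    rw [← hx] at h1 h2
    refine ⟨k, ?_, h1, h2⟩
    rintro rfl
    exact hG (by rw [h2, zero_mul])

/-- The polynomial identities showing that the two forms of the duplication formula have no
common zero. -/
theorem bezout_num {R : Type*} [CommRing R] (b c r s : R) (hc : c ^ 2 = 4 * b + 16) :
    (-12 * b ^ 2 * r * s ^ 2 - 8 * b * c * r ^ 2 * s + 64 * r ^ 3) * (r ^ 2 - b * s ^ 2) ^ 2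
      + (3 * b ^ 3 * s ^ 3 - b ^ 2 * c * r * s ^ 2 - 5 * b ^ 2 * r ^ 2 * s + 2 * b * c * r ^ 3)
        * (4 * r * s * (r ^ 2 + c * r * s + b * s ^ 2)) = 64 * r ^ 7 := by
  linear_combination (-4 * b ^ 2 * r ^ 3 * s ^ 4 + 8 * b * r ^ 5 * s ^ 2) * hc

theorem bezout_den {R : Type*} [CommRing R] (b c r s : R) (hc : c ^ 2 = 4 * b + 16) :
    (64 * s ^ 3 - 8 * c * r * s ^ 2 - 12 * r ^ 2 * s) * (r ^ 2 - b * s ^ 2) ^ 2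
      + (2 * b * c * s ^ 3 - 5 * b * r * s ^ 2 - c * r ^ 2 * s + 3 * r ^ 3)
        * (4 * r * s * (r ^ 2 + c * r * s + b * s ^ 2)) = 64 * b ^ 2 * s ^ 7 := by
  linear_combination (8 * b * r ^ 2 * s ^ 5 - 4 * r ^ 4 * s ^ 3) * hc

theorem E_equation {a : ℤ} {x y : ℚ} (h : (E a).Nonsingular x y) :
    y ^ 2 = x * (x ^ 2 + 2 * (a : ℚ) ^ 2 * x + ((a : ℚ) ^ 4 - 4)) := by
  have := (WeierstrassCurve.Affine.equation_iff ..).mp h.1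
  simp only [E] at this
  linarith

theorem two_smul_of_y_eq_zero {a : ℤ} {x y : ℚ} (h : (E a).Nonsingular x y) (hy : y = 0) :
    2 • (WeierstrassCurve.Affine.Point.some x y h) = .zero := by
  rw [two_smul, WeierstrassCurve.Affine.Point.add_self_of_Y_eq (by simp [E, hy])]
  rfl

theorem two_smul_of_y_ne_zero {a : ℤ} {x y : ℚ} (h : (E a).Nonsingular x y) (hy : y ≠ 0) :
    ∃ y' h', 2 • (WeierstrassCurve.Affine.Point.some x y h) =
      .some ((x ^ 2 - ((a : ℚ) ^ 4 - 4)) ^ 2 / (4 * y ^ 2)) y' h' := by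
  have heq := E_equation h
  have hne : y ≠ (E a).negY x y := by
    simp only [WeierstrassCurve.Affine.negY, E]
    intro h'
    exact hy (by linarith)
  have hx : (E a).addX x x ((E a).slope x x y y) =
      (x ^ 2 - ((a : ℚ) ^ 4 - 4)) ^ 2 / (4 * y ^ 2) := by
    rw [WeierstrassCurve.Affine.slope_of_Y_ne rfl hne]
    simp only [WeierstrassCurve.Affine.addX, WeierstrassCurve.Affine.negY, E]
    have : y - (-y - 0 * x - 0) = 2 * y := by ring
    rw [this]
    field_simp
    linear_combination (-32 * (a : ℚ) ^ 2 - 32 * x) * heq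
  rw [two_smul, WeierstrassCurve.Affine.Point.add_self_of_Y_ne hne, ← hx]
  exact ⟨_, _, rfl⟩

/-- The duplication formula in terms of numerators and denominators. -/
theorem hasXCoord_two_smul {a : ℤ} (P : (E a).Point) :
    HasXCoord ((xNum P ^ 2 - (a ^ 4 - 4) * xDen P ^ 2) ^ 2)
      (4 * xNum P * xDen P *
        (xNum P ^ 2 + 2 * a ^ 2 * xNum P * xDen P + (a ^ 4 - 4) * xDen P ^ 2)) (2 • P) := by
  rcases P with _ | ⟨x, y, h⟩
  · have : (2 • (WeierstrassCurve.Affine.Point.zero : (E a).Point)) = .zero :=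
      smul_zero (A := (E a).Point) 2
    rw [this]
    simp [HasXCoord, xNum, xDen]
  · have heq := E_equation h
    have hs : (x.den : ℚ) ≠ 0 := mod_cast x.den_nz
    have hx : (x.num : ℚ) = x * x.den := (Rat.mul_den_eq_num x).symm
    have hF : (((x.num ^ 2 - (a ^ 4 - 4) * (x.den : ℤ) ^ 2) ^ 2 : ℤ) : ℚ)
        = x.den ^ 4 * (x ^ 2 - ((a : ℚ) ^ 4 - 4)) ^ 2 := by
      push_cast; rw [hx]; ring
    have hG : ((4 * x.num * (x.den : ℤ) * (x.num ^ 2 + 2 * a ^ 2 * x.num * (x.den : ℤ)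
        + (a ^ 4 - 4) * (x.den : ℤ) ^ 2) : ℤ) : ℚ) = x.den ^ 4 * (4 * y ^ 2) := by
      push_cast; rw [hx, heq]; ring
    by_cases hy : y = 0
    · rw [two_smul_of_y_eq_zero h hy]
      rw [hy] at hG
      have hG0 : 4 * x.num * (x.den : ℤ) * (x.num ^ 2 + 2 * a ^ 2 * x.num * (x.den : ℤ)
        + (a ^ 4 - 4) * (x.den : ℤ) ^ 2) = 0 := by
        have := hG.trans (by ring : _ = (0 : ℚ))
        exact_mod_cast this
      refine ⟨fun hF0 => ?_, hG0⟩
      simp only [xNum, xDen] at hF0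
      -- If both forms vanished, the Bézout identity would give 64 b² s⁷ = 0.
      have := bezout_den (a ^ 4 - 4) (2 * a ^ 2) x.num (x.den : ℤ) (by ring)
      rw [hF0, hG0] at this
      have hb : a ^ 4 - 4 ≠ 0 := by exact_mod_cast four_ne a
      have hd : (x.den : ℤ) ≠ 0 := mod_cast x.den_nz
      have : 64 * (a ^ 4 - 4) ^ 2 * (x.den : ℤ) ^ 7 ≠ 0 := by positivity
      omega
    · obtain ⟨y', h', h2⟩ := two_smul_of_y_ne_zero h hy
      rw [h2]
      refine ⟨?_, ?_⟩
      · intro h0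
        simp only [xNum, xDen] at h0
        rw [h0] at hG
        have : (x.den : ℚ) ^ 4 * (4 * y ^ 2) ≠ 0 := by positivity
        exact this (by rw [← hG]; simp)
      · simp only [xNum, xDen]
        rw [hF, hG]
        field_simp

/-- The x-coordinate of a double is the square (x² - b)²/(4y²), or the point is 𝓞, with numerator 1.
-/
theorem xNum_two_smul_nonneg {a : ℤ} (P : (E a).Point) : 0 ≤ xNum (2 • P) := by
  rcases P with _ | ⟨x, y, h⟩
  · have : (2 • (WeierstrassCurve.Affine.Point.zero : (E a).Point)) = .zero :=
      smul_zero (A := (E a).Point) 2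
    rw [this]
    exact zero_le_one
  · by_cases hy : y = 0
    · rw [two_smul_of_y_eq_zero h hy]
      exact zero_le_one
    · obtain ⟨y', h', h2⟩ := two_smul_of_y_ne_zero h hy
      rw [h2]
      exact Rat.num_nonneg.mpr (by positivity)

/-- The content of the pair of values of the duplication forms is bounded. -/
theorem abs_le_of_dvd_duplication {b c r s k : ℤ} (hc : c ^ 2 = 4 * b + 16) (hb : b ≠ 0)
    (hrs : IsCoprime r s) (hF : k ∣ (r ^ 2 - b * s ^ 2) ^ 2)
    (hG : k ∣ 4 * r * s * (r ^ 2 + c * r * s + b * s ^ 2)) : |k| ≤ 64 * b ^ 2 := by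
  have h1 : k ∣ 64 * r ^ 7 := by
    rw [← bezout_num b c r s hc]
    exact dvd_add (hF.mul_left _) (hG.mul_left _)
  have h2 : k ∣ 64 * b ^ 2 * s ^ 7 := by
    rw [← bezout_den b c r s hc]
    exact dvd_add (hF.mul_left _) (hG.mul_left _)
  obtain ⟨u, v, huv⟩ := (hrs.pow (m := 7) (n := 7))
  have h3 : k ∣ 64 * b ^ 2 := by
    have : 64 * b ^ 2 = u * b ^ 2 * (64 * r ^ 7) + v * (64 * b ^ 2 * s ^ 7) := by
      linear_combination (-64 * b ^ 2) * huv
    rw [this]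
    exact dvd_add (h1.mul_left _) (h2.mul_left _)
  exact Int.le_of_dvd (by positivity) ((abs_dvd _ _).mpr h3)

/-! ### Change of the scaled height under doubling. -/

/-- The height of the `x`-coordinate in which the real absolute values are rescaled to the size
of the roots of the cubic. -/
noncomputable def scaledHeight {a : ℤ} (P : (E a).Point) : ℝ :=
  Real.log (max |(xNum P : ℝ)| ((a : ℝ) ^ 2 * xDen P))

theorem one_le_sq_cast {a : ℤ} (ha : a ≠ 0) : (1 : ℝ) ≤ (a : ℝ) ^ 2 := by
  have : 0 < a ^ 2 := by positivity
  exact_mod_cast this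

theorem one_le_max_xNum_xDen {a : ℤ} (ha : a ≠ 0) (P : (E a).Point) :
    1 ≤ max |(xNum P : ℝ)| ((a : ℝ) ^ 2 * xDen P) := by
  rcases P with _ | ⟨x, y, h⟩
  · simp [xNum]
  · refine le_max_of_le_right ?_
    have h1 := one_le_sq_cast ha
    have h2 : (1 : ℝ) ≤ x.den := mod_cast x.den_pos
    simp only [xDen, Int.cast_natCast]
    nlinarith

/-- Weighting one entry by a² ≥ 1 multiplies the maximum by a factor in [1, a²], so both heights
have the same limit under 4⁻ⁿ-scaling. -/
theorem scaledHeight_sub_naiveHeight {a : ℤ} (ha : a ≠ 0) (P : (E a).Point) :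
    |scaledHeight P - naiveHeight P| ≤ Real.log ((a : ℝ) ^ 2) := by
  have h1 := one_le_sq_cast ha
  have hl := Real.log_nonneg h1
  rcases P with _ | ⟨x, y, h⟩
  · simpa [scaledHeight, naiveHeight, xNum, xDen] using hl
  · have hden : (1 : ℝ) ≤ x.den := mod_cast x.den_pos
    have hM : (1 : ℝ) ≤ max |(x.num : ℝ)| x.den := le_max_of_le_right hden
    have hM' : (1 : ℝ) ≤ max |(x.num : ℝ)| ((a : ℝ) ^ 2 * x.den) :=
      one_le_max_xNum_xDen ha (.some x y h)
    have e : naiveHeight (WeierstrassCurve.Affine.Point.some x y h)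
        = Real.log (max |(x.num : ℝ)| x.den) := by
      simp only [naiveHeight, Rat.logHeight₁_eq_log_max]
      push_cast [Nat.cast_natAbs]
      rfl
    have l1 : Real.log (max |(x.num : ℝ)| x.den)
        ≤ Real.log (max |(x.num : ℝ)| ((a : ℝ) ^ 2 * x.den)) := by
      apply Real.log_le_log (by linarith)
      exact max_le_max le_rfl (by nlinarith)
    have l2 : Real.log (max |(x.num : ℝ)| ((a : ℝ) ^ 2 * x.den))
        ≤ Real.log ((a : ℝ) ^ 2) + Real.log (max |(x.num : ℝ)| x.den) := by
      rw [← Real.log_mul (by linarith) (by linarith)]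
      apply Real.log_le_log (by linarith)
      refine max_le ?_ (by gcongr; exact le_max_right _ _)
      have := le_max_left |(x.num : ℝ)| x.den
      nlinarith
    rw [e]
    change |Real.log (max |(x.num : ℝ)| ((a : ℝ) ^ 2 * x.den)) - _| ≤ _
    rw [abs_of_nonneg (by linarith)]
    linarith

theorem duplication_le {r S B : ℝ} (hr : 0 ≤ r) (hS : 0 ≤ S) (hB : |B| ≤ 3 * S ^ 2) :
    max ((r ^ 2 - B) ^ 2) |4 * r * S * (r ^ 2 + 2 * r * S + B)| ≤ 24 * max r S ^ 4 := by
  set A := max r S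
  have h1 : r ≤ A := le_max_left _ _
  have h2 : S ≤ A := le_max_right _ _
  have hA : 0 ≤ A := hr.trans h1
  have h3 : r ^ 2 ≤ A ^ 2 := by gcongr
  have h4 : S ^ 2 ≤ A ^ 2 := by gcongr
  have h5 : r * S ≤ A ^ 2 := by rw [pow_two]; gcongr
  have h6 : 0 ≤ r * S := mul_nonneg hr hS
  obtain ⟨hB1, hB2⟩ := abs_le.mp hB
  refine max_le ?_ ?_
  · have : |r ^ 2 - B| ≤ 4 * A ^ 2 := by
      rw [abs_le]
      constructor <;> nlinarith [sq_nonneg r, sq_nonneg S]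
    have h7 := pow_le_pow_left₀ (abs_nonneg _) this 2
    rw [sq_abs] at h7
    nlinarith [sq_nonneg (A ^ 2)]
  · have h8 : |r ^ 2 + 2 * r * S + B| ≤ 6 * A ^ 2 := by
      rw [abs_le]
      constructor <;> nlinarith [sq_nonneg r, sq_nonneg S]
    rw [abs_mul, abs_of_nonneg (by nlinarith : 0 ≤ 4 * r * S)]
    calc 4 * r * S * |r ^ 2 + 2 * r * S + B| ≤ 4 * A ^ 2 * (6 * A ^ 2) :=
          mul_le_mul (by linarith) h8 (abs_nonneg _) (by positivity)
      _ = 24 * A ^ 4 := by ring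

/-- The two forms cannot both be small when r, S ≥ 0. Here S = a²s and B = bs². For a² = 1 one has B
= -3S², and r² - B has no cancellation. For a² ≥ 4, r² - B is small only for r comparable to S,
where the other form has all terms nonnegative and is large. -/
theorem le_duplication {r S B : ℝ} (hr : 0 ≤ r) (hS : 0 ≤ S)
    (hB : B = -3 * S ^ 2 ∨ 3 / 4 * S ^ 2 ≤ B ∧ B ≤ S ^ 2) :
    max r S ^ 4 ≤ 4 * max ((r ^ 2 - B) ^ 2) |4 * r * S * (r ^ 2 + 2 * r * S + B)| := by
  set M := max ((r ^ 2 - B) ^ 2) |4 * r * S * (r ^ 2 + 2 * r * S + B)|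
  have hM1 : (r ^ 2 - B) ^ 2 ≤ M := le_max_left _ _
  have hM2 : 4 * r * S * (r ^ 2 + 2 * r * S + B) ≤ M := (le_abs_self _).trans (le_max_right _ _)
  have hr2 := sq_nonneg r
  have hS2 := sq_nonneg S
  have sq_le {u v : ℝ} (hu : 0 ≤ u) (h : u ≤ 2 * |v|) : u ^ 2 ≤ 4 * v ^ 2 := by
    have := pow_le_pow_left₀ hu h 2
    rw [mul_pow, sq_abs] at this
    linarith
  rcases hB with hB | ⟨hB1, hB2⟩
  · have h1 : max r S ^ 2 ≤ 2 * |r ^ 2 - B| := by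
      rw [abs_of_nonneg (by rw [hB]; nlinarith)]
      rcases max_cases r S with ⟨h, _⟩ | ⟨h, _⟩ <;> rw [h] <;> nlinarith
    have := sq_le (sq_nonneg _) h1
    calc max r S ^ 4 = (max r S ^ 2) ^ 2 := by ring
      _ ≤ 4 * M := by linarith
  · rcases le_total r S with h | h
    · rw [max_eq_right h]
      -- For 4r ≤ S, B - r² ≥ (3/4 - 1/16)S²; otherwise both factors of the second form are at least
      -- S².
      rcases le_total (4 * r) S with h4 | h4
      · have h1 : S ^ 2 ≤ 2 * |r ^ 2 - B| := by
          rw [abs_of_nonpos (by nlinarith)]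
          nlinarith
        have := sq_le (sq_nonneg _) h1
        calc S ^ 4 = (S ^ 2) ^ 2 := by ring
          _ ≤ 4 * M := by linarith
      · have h1 : S ^ 2 ≤ 4 * r * S := by nlinarith
        have h2 : S ^ 2 ≤ r ^ 2 + 2 * r * S + B := by nlinarith
        have h3 : S ^ 2 * S ^ 2 ≤ 4 * r * S * (r ^ 2 + 2 * r * S + B) := by gcongr
        nlinarith [sq_nonneg (S ^ 2)]
    · rw [max_eq_left h]
      -- For r ≥ 2S, r² - B ≥ r² - S² ≥ (3/4)r²; otherwise both factors of the second form are at
      -- least r².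
      rcases le_total (2 * S) r with h4 | h4
      · have h1 : r ^ 2 ≤ 2 * |r ^ 2 - B| := by
          rw [abs_of_nonneg (by nlinarith)]
          nlinarith
        have := sq_le (sq_nonneg _) h1
        calc r ^ 4 = (r ^ 2) ^ 2 := by ring
          _ ≤ 4 * M := by linarith
      · have h1 : r ^ 2 ≤ 4 * r * S := by nlinarith
        have h2 : r ^ 2 ≤ r ^ 2 + 2 * r * S + B := by nlinarith
        have h3 : r ^ 2 * r ^ 2 ≤ 4 * r * S * (r ^ 2 + 2 * r * S + B) := by gcongr
        nlinarith [sq_nonneg (r ^ 2)]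

theorem scaledHeight_of_scale {a F G k : ℤ} (ha : a ≠ 0) (hk : k ≠ 0) {P : (E a).Point}
    (hF : F = k * xNum P) (hG : G = k * xDen P) :
    Real.log (max |(F : ℝ)| ((a : ℝ) ^ 2 * |(G : ℝ)|)) = Real.log |(k : ℝ)| + scaledHeight P := by
  have hk' : |(k : ℝ)| ≠ 0 := by simpa using hk
  have hM := one_le_max_xNum_xDen ha P
  have hD : (0 : ℝ) ≤ xDen P := by exact_mod_cast xDen_nonneg P
  rw [scaledHeight, ← Real.log_mul hk' (by linarith), mul_max_of_nonneg _ _ (abs_nonneg _), hF, hG]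
  push_cast
  rw [abs_mul, abs_mul, abs_of_nonneg hD]
  congr 2
  ring

theorem sq_eq_one_or_four_le_sq {a : ℤ} (ha : a ≠ 0) : a ^ 2 = 1 ∨ 4 ≤ a ^ 2 := by
  have h0 : 0 < a ^ 2 := by positivity
  rcases le_or_gt (a ^ 2) 3 with h | h
  · have h1 : a < 2 := by nlinarith
    have h2 : -2 < a := by nlinarith
    interval_cases a <;> simp_all
  · exact Or.inr h

theorem scaledHeight_two_smul {a : ℤ} (ha : a ≠ 0) (P : (E a).Point) (hP : 0 ≤ xNum P) :
    scaledHeight (2 • P) ≤ 4 * scaledHeight P + Real.log 24 ∧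
    4 * scaledHeight P ≤ scaledHeight (2 • P) + Real.log (2304 * (a : ℝ) ^ 8) := by
  obtain ⟨k, hk, hF, hG⟩ := (hasXCoord_two_smul P).exists_scale
  have hb : a ^ 4 - 4 ≠ 0 := by exact_mod_cast four_ne a
  have hk64 := abs_le_of_dvd_duplication (c := 2 * a ^ 2) (by ring) hb (isCoprime_xNum_xDen P)
    ⟨_, hF⟩ ⟨_, hG⟩
  have hlog := scaledHeight_of_scale ha hk hF hG
  have ha1 := one_le_sq_cast ha
  have hk1 : (1 : ℝ) ≤ |(k : ℝ)| := by exact_mod_cast Int.one_le_abs hk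
  have hr : (0 : ℝ) ≤ xNum P := by exact_mod_cast hP
  have hs : (0 : ℝ) ≤ xDen P := by exact_mod_cast xDen_nonneg P
  have hM1 := one_le_max_xNum_xDen ha P
  set r : ℝ := (xNum P : ℝ) with hrdef
  set s : ℝ := (xDen P : ℝ) with hsdef
  set S : ℝ := (a : ℝ) ^ 2 * s with hSdef
  set B : ℝ := ((a : ℝ) ^ 4 - 4) * s ^ 2 with hBdef
  have hS : 0 ≤ S := by positivity
  have hBcases : B = -3 * S ^ 2 ∨ 3 / 4 * S ^ 2 ≤ B ∧ B ≤ S ^ 2 := by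
    have e : S ^ 2 = ((a : ℝ) ^ 2) ^ 2 * s ^ 2 := by rw [hSdef]; ring
    have e' : B = (((a : ℝ) ^ 2) ^ 2 - 4) * s ^ 2 := by rw [hBdef]; ring
    rw [e, e']
    rcases sq_eq_one_or_four_le_sq ha with h | h
    · left
      have : (a : ℝ) ^ 2 = 1 := by exact_mod_cast h
      rw [this]; ring
    · right
      have : (4 : ℝ) ≤ (a : ℝ) ^ 2 := by exact_mod_cast h
      have h16 : (16 : ℝ) ≤ ((a : ℝ) ^ 2) ^ 2 := by nlinarith
      have := mul_nonneg (sub_nonneg.mpr h16) (sq_nonneg s)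
      constructor <;> nlinarith [sq_nonneg s]
  have hBabs : |B| ≤ 3 * S ^ 2 := by
    rw [abs_le]
    rcases hBcases with h | ⟨h1, h2⟩
    · constructor <;> nlinarith [sq_nonneg S]
    · constructor <;> nlinarith [sq_nonneg S]
  have eM : max |(((xNum P ^ 2 - (a ^ 4 - 4) * xDen P ^ 2) ^ 2 : ℤ) : ℝ)| ((a : ℝ) ^ 2 *
      |((4 * xNum P * xDen P * (xNum P ^ 2 + 2 * a ^ 2 * xNum P * xDen P
        + (a ^ 4 - 4) * xDen P ^ 2) : ℤ) : ℝ)|)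
      = max ((r ^ 2 - B) ^ 2) |4 * r * S * (r ^ 2 + 2 * r * S + B)| := by
    push_cast
    rw [abs_of_nonneg (by positivity), ← abs_of_nonneg (sq_nonneg (a : ℝ)), ← abs_mul,
      abs_of_nonneg (sq_nonneg (a : ℝ))]
    congr 2
    rw [hSdef, hBdef, hrdef, hsdef]; ring
  rw [eM] at hlog
  have hsc : scaledHeight P = Real.log (max r S) := by rw [scaledHeight, abs_of_nonneg hr]
  rw [abs_of_nonneg hr] at hM1
  have hpos : 0 < max r S ^ 4 := by positivity
  have hup := duplication_le hr hS hBabs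
  have hlo := le_duplication hr hS hBcases
  have hDpos : 0 < max ((r ^ 2 - B) ^ 2) |4 * r * S * (r ^ 2 + 2 * r * S + B)| := by linarith
  have hlk := Real.log_nonneg hk1
  have hlup := Real.log_le_log hDpos hup
  have hllo := Real.log_le_log hpos hlo
  rw [Real.log_mul (by norm_num) hpos.ne', Real.log_pow] at hlup
  rw [Real.log_mul (by norm_num) hDpos.ne', Real.log_pow] at hllo
  push_cast at hlup hllo
  rw [hsc]
  refine ⟨by linarith, ?_⟩
  -- As |a⁴ - 4| ≤ 3a⁴, the content is at most 64 · 9 · a⁸; the factor 4 of the real estimate turns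
  -- 576 into 2304.
  have hk' : |(k : ℝ)| ≤ 576 * (a : ℝ) ^ 8 := by
    have h1 : |(k : ℝ)| ≤ 64 * ((a : ℝ) ^ 4 - 4) ^ 2 := by exact_mod_cast hk64
    have h2 : (1 : ℝ) ≤ (a : ℝ) ^ 4 := by nlinarith
    nlinarith
  have hlk2 := Real.log_le_log (by linarith) hk'
  have e : Real.log (2304 * (a : ℝ) ^ 8) = Real.log 4 + Real.log (576 * (a : ℝ) ^ 8) := by
    rw [← Real.log_mul (by norm_num) (by positivity)]
    congr 1; ring
  rw [e]
  linarith

/-! ### Comparison of the scaled and canonical heights. -/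

/-- Tate's telescoping: u + C/3 grows by at most a factor 4 at each step. -/
theorem le_of_tendsto_div_four_pow {u : ℕ → ℝ} {C L : ℝ} (hu : ∀ n, u (n + 1) ≤ 4 * u n + C)
    (hL : Tendsto (fun n => u n / (4 : ℝ) ^ n) atTop (𝓝 L)) : L ≤ u 0 + C / 3 := by
  have h : ∀ n, u n + C / 3 ≤ 4 ^ n * (u 0 + C / 3) := by
    intro n
    induction n with
    | zero => simp
    | succ n ih => rw [pow_succ]; linarith [hu n]
  have hC : Tendsto (fun n : ℕ => C / 3 / (4 : ℝ) ^ n) atTop (𝓝 0) :=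
    tendsto_const_nhds.div_atTop (tendsto_pow_atTop_atTop_of_one_lt (by norm_num))
  have hsum := hL.add hC
  rw [add_zero] at hsum
  refine le_of_tendsto' hsum fun n => ?_
  rw [← add_div, div_le_iff₀ (by positivity)]
  linarith [h n]

theorem tendsto_scaledHeight {a : ℤ} (ha : a ≠ 0) (P : (E a).Point) :
    Tendsto (fun n : ℕ => scaledHeight ((2 ^ n : ℕ) • P) / (4 : ℝ) ^ n) atTop
      (𝓝 (canonicalHeight P)) := by
  have h0 : Tendsto (fun n : ℕ => Real.log ((a : ℝ) ^ 2) / (4 : ℝ) ^ n) atTop (𝓝 0) :=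
    tendsto_const_nhds.div_atTop (tendsto_pow_atTop_atTop_of_one_lt (by norm_num))
  have h1 : Tendsto (fun n : ℕ => scaledHeight ((2 ^ n : ℕ) • P) / (4 : ℝ) ^ n
      - naiveHeight ((2 ^ n : ℕ) • P) / (4 : ℝ) ^ n) atTop (𝓝 0) := by
    refine squeeze_zero_norm (fun n => ?_) h0
    rw [← sub_div, Real.norm_eq_abs, abs_div, abs_of_pos (by positivity : (0 : ℝ) < 4 ^ n)]
    gcongr
    exact scaledHeight_sub_naiveHeight ha _
  simpa using h1.add (tendsto_canonicalHeight P)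

theorem canonicalHeight_two_smul {a : ℤ} (P : (E a).Point) :
    canonicalHeight (2 • P) = 4 * canonicalHeight P := by
  have h1 := ((tendsto_canonicalHeight P).comp (tendsto_add_atTop_nat 1)).const_mul 4
  refine tendsto_nhds_unique (tendsto_canonicalHeight (2 • P)) (h1.congr fun n => ?_)
  simp only [Function.comp, smul_smul, ← pow_succ]
  field_simp
  ring

theorem canonicalHeight_sub_scaledHeight {a : ℤ} (ha : a ≠ 0) (P : (E a).Point)
    (hP : 0 ≤ xNum P) :
    canonicalHeight P ≤ scaledHeight P + Real.log 24 / 3 ∧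
    scaledHeight P ≤ canonicalHeight P + Real.log (2304 * (a : ℝ) ^ 8) / 3 := by
  have hnonneg (n : ℕ) : 0 ≤ xNum ((2 ^ n : ℕ) • P) := by
    cases n with
    | zero => simpa using hP
    | succ n => rw [pow_succ', mul_smul]; exact xNum_two_smul_nonneg _
  have hstep (n : ℕ) := scaledHeight_two_smul ha _ (hnonneg n)
  simp only [smul_smul, ← pow_succ'] at hstep
  have hL := tendsto_scaledHeight ha P
  have h1 := le_of_tendsto_div_four_pow (fun n => (hstep n).1) hL
  -- The lower bound is the same telescoping applied to the negated heights.
  have h2 := le_of_tendsto_div_four_pow (u := fun n => -scaledHeight ((2 ^ n : ℕ) • P))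
    (C := Real.log (2304 * (a : ℝ) ^ 8)) (L := -canonicalHeight P)
    (fun n => by linarith [(hstep n).2]) (by simpa only [neg_div] using hL.neg)
  simp only [pow_zero, one_smul] at h1 h2
  exact ⟨h1, by linarith⟩

/-! ### The 2-isogeny and the heights of the doubled points. -/

/-- With X = n/m the curve equation reads x² + b = x(4X - 2a²), so (x² - b)² = (x² + b)² - 4bx² =
16x²(X² - a²X + 1). -/
theorem sq_mul_sq_sub_eq {a x y n m : ℚ} (hx : x ≠ 0)
    (heq : y ^ 2 = x * (x ^ 2 + 2 * a ^ 2 * x + (a ^ 4 - 4))) (hX : y ^ 2 * m = 4 * x ^ 2 * n) :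
    m ^ 2 * (x ^ 2 - (a ^ 4 - 4)) ^ 2 = 16 * x ^ 2 * (m ^ 2 - n * (a ^ 2 * m - n)) := by
  have h1 : m * (x ^ 2 + 2 * a ^ 2 * x + (a ^ 4 - 4)) = 4 * x * n := by
    refine mul_left_cancel₀ hx ?_
    linear_combination hX - m * heq
  linear_combination (m * (x ^ 2 - 2 * a ^ 2 * x + (a ^ 4 - 4)) + 4 * x * n) * h1

/-- The duplication map through the `2`-isogeny `(x, y) ↦ y² / (4x²)`. -/
theorem hasXCoord_two_smul_of_isogeny {a : ℤ} {x y : ℚ} (h : (E a).Nonsingular x y) (hx : x ≠ 0)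
    {n m : ℤ} (hm : m ≠ 0) (hX : y ^ 2 * m = 4 * x ^ 2 * n) :
    HasXCoord (m ^ 2 - n * (a ^ 2 * m - n)) (m * n)
      (2 • WeierstrassCurve.Affine.Point.some x y h) := by
  have hmQ : (m : ℚ) ≠ 0 := mod_cast hm
  by_cases hy : y = 0
  · have hn : n = 0 := by
      have : 4 * x ^ 2 * (n : ℚ) = 0 := by rw [← hX, hy]; ring
      have h4 : 4 * x ^ 2 ≠ 0 := by positivity
      exact_mod_cast (mul_eq_zero.mp this).resolve_left h4
    rw [two_smul_of_y_eq_zero h hy, hn]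
    exact ⟨by simpa using hm, mul_zero m⟩
  · have hn : (n : ℚ) ≠ 0 := by
      intro h0
      rw [h0, mul_zero] at hX
      exact (mul_ne_zero (pow_ne_zero 2 hy) hmQ) hX
    obtain ⟨y', h', h2⟩ := two_smul_of_y_ne_zero h hy
    rw [h2]
    refine ⟨mul_ne_zero hm (mod_cast hn), ?_⟩
    have key := sq_mul_sq_sub_eq hx (E_equation h) hX
    push_cast
    rw [div_eq_div_iff (by positivity) (mul_ne_zero hmQ hn)]
    refine mul_left_cancel₀ hmQ ?_
    linear_combination (n : ℚ) * key
      - 4 * ((m : ℚ) ^ 2 - n * (a ^ 2 * m - n)) * hX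

theorem isCoprime_isogeny {a n m : ℤ} (h : IsCoprime n m) :
    IsCoprime (m ^ 2 - n * (a ^ 2 * m - n)) (m * n) := by
  refine IsCoprime.mul_right ?_ ?_
  · have h1 : IsCoprime (n ^ 2) m := h.pow_left
    have : m ^ 2 - n * (a ^ 2 * m - n) = n ^ 2 + m * (m - n * a ^ 2) := by ring
    rw [this]
    exact h1.add_mul_left_left _
  · have h1 : IsCoprime (m ^ 2) n := h.symm.pow_left
    have : m ^ 2 - n * (a ^ 2 * m - n) = m ^ 2 + n * (-(a ^ 2 * m - n)) := by ring
    rw [this]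
    exact h1.add_mul_left_left _

theorem scaledHeight_of_isCoprime {a F G : ℤ} (ha : a ≠ 0) {P : (E a).Point}
    (h : HasXCoord F G P) (hFG : IsCoprime F G) :
    scaledHeight P = Real.log (max |(F : ℝ)| ((a : ℝ) ^ 2 * |(G : ℝ)|)) := by
  obtain ⟨k, hk, hF, hG⟩ := h.exists_scale
  have hu : IsUnit k := hFG.isUnit_of_dvd' ⟨_, hF⟩ ⟨_, hG⟩
  have hk1 : |(k : ℝ)| = 1 := by exact_mod_cast Int.isUnit_iff_abs_eq.mp hu
  rw [scaledHeight_of_scale ha hk hF hG, hk1, Real.log_one, zero_add]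

/-- Both maxima are compared with m²: the left one is at most A²m², the right one at least m²/2. -/
theorem max_isogeny_le {A m n n' : ℝ} (hA : 1 ≤ A) (hm : 0 < m) (hn : 0 ≤ n) (hn' : 0 ≤ n')
    (hsum : n + n' = A * m) (hN : 0 ≤ m ^ 2 - n * n') :
    max |m ^ 2 - n * n'| (A * |m * n|) ≤ 2 * A ^ 2 * max |m ^ 2 - n * n'| (A * |m * n'|) := by
  rw [abs_of_nonneg hN, abs_of_nonneg (by positivity), abs_of_nonneg (by positivity)]
  have hA2 : 1 ≤ A ^ 2 := one_le_pow₀ hA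
  have h1 : max (m ^ 2 - n * n') (A * (m * n)) ≤ A ^ 2 * m ^ 2 := by
    refine max_le ?_ ?_
    · nlinarith [mul_nonneg hn hn', sq_nonneg m]
    · have : n ≤ A * m := by linarith
      calc A * (m * n) ≤ A * (m * (A * m)) := by gcongr
        _ = A ^ 2 * m ^ 2 := by ring
  have h2 : m ^ 2 ≤ 2 * max (m ^ 2 - n * n') (A * (m * n')) := by
    -- Either Amn' ≥ m²/2, or nn' ≤ Amn' ≤ m²/2 and the first entry is at least m²/2.
    rcases le_total m (2 * (A * n')) with h | h
    · have := le_max_right (m ^ 2 - n * n') (A * (m * n'))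
      nlinarith
    · have := le_max_left (m ^ 2 - n * n') (A * (m * n'))
      have h3 : n * n' ≤ A * m * n' := by gcongr; linarith
      nlinarith
  calc _ ≤ A ^ 2 * m ^ 2 := h1
    _ ≤ A ^ 2 * (2 * max (m ^ 2 - n * n') (A * (m * n'))) := by gcongr
    _ = _ := by ring

theorem one_le_max_of_isCoprime {a F G : ℤ} (ha : a ≠ 0) (h : IsCoprime F G) :
    1 ≤ max |(F : ℝ)| ((a : ℝ) ^ 2 * |(G : ℝ)|) := by
  by_cases hF : F = 0
  · have hG : G ≠ 0 := by
      rintro rfl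
      rw [hF] at h
      exact not_isCoprime_zero_zero h
    refine le_max_of_le_right ?_
    have h1 : (1 : ℝ) ≤ |(G : ℝ)| := by exact_mod_cast Int.one_le_abs hG
    have h2 := one_le_sq_cast ha
    nlinarith
  · exact le_max_of_le_left (by exact_mod_cast Int.one_le_abs hF)

theorem scaledHeight_two_smul_le {a : ℤ} (ha : a ≠ 0) {x₁ y₁ x₂ y₂ : ℚ}
    (h₁ : (E a).Nonsingular x₁ y₁) (h₂ : (E a).Nonsingular x₂ y₂)
    (hx : x₁ * x₂ = -((a : ℚ) ^ 4 - 4)) :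
    scaledHeight (2 • WeierstrassCurve.Affine.Point.some x₁ y₁ h₁) ≤
      Real.log (2 * (a : ℝ) ^ 4)
        + scaledHeight (2 • WeierstrassCurve.Affine.Point.some x₂ y₂ h₂) := by
  have hprod : x₁ * x₂ ≠ 0 := by rw [hx]; exact neg_ne_zero.mpr (four_ne a)
  have hx₁ := left_ne_zero_of_mul hprod
  have hx₂ := right_ne_zero_of_mul hprod
  have e₁ := E_equation h₁
  have e₂ := E_equation h₂
  obtain ⟨X, hXdef⟩ : ∃ X : ℚ, X = y₁ ^ 2 / (4 * x₁ ^ 2) := ⟨_, rfl⟩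
  have hX : y₁ ^ 2 = 4 * x₁ ^ 2 * X := by rw [hXdef]; field_simp
  -- Since x₂ = -b/x₁, the sums x + b/x at the two points are opposite, so the isogeny coordinates
  -- add up to a².
  have hX' : y₂ ^ 2 = 4 * x₂ ^ 2 * ((a : ℚ) ^ 2 - X) := by
    have h1 : x₁ ^ 2 + 2 * (a : ℚ) ^ 2 * x₁ + ((a : ℚ) ^ 4 - 4) = 4 * x₁ * X := by
      refine mul_left_cancel₀ hx₁ ?_
      linear_combination hX - e₁
    refine mul_left_cancel₀ hx₁ ?_
    linear_combination x₁ * e₂ - x₂ ^ 2 * h1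
      + (x₁ * x₂ + x₂ ^ 2) * hx
  have hX0 : 0 ≤ X := by rw [hXdef]; positivity
  have hX0' : 0 ≤ (a : ℚ) ^ 2 - X := by
    have : 0 ≤ 4 * x₂ ^ 2 * ((a : ℚ) ^ 2 - X) := by rw [← hX']; positivity
    exact nonneg_of_mul_nonneg_right this (by positivity)
  have hcop := Rat.isCoprime_num_den X
  have hnum : X * X.den = X.num := Rat.mul_den_eq_num X
  have hn : 0 ≤ X.num := Rat.num_nonneg.mpr hX0
  have hm : (0 : ℤ) < X.den := mod_cast X.den_pos
  have hmQ : (X.den : ℚ) = ((X.den : ℤ) : ℚ) := (Int.cast_natCast _).symm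
  rw [hmQ] at hnum
  generalize (X.den : ℤ) = m at *
  generalize X.num = n at *
  have hmQ' : (0 : ℚ) < m := mod_cast hm
  have hn' : 0 ≤ a ^ 2 * m - n := by
    have : (0 : ℚ) ≤ a ^ 2 * m - n := by rw [← hnum, ← sub_mul]; positivity
    exact_mod_cast this
  have hcop' : IsCoprime (a ^ 2 * m - n) m := by
    have : a ^ 2 * m - n = -n + m * a ^ 2 := by ring
    rw [this]
    exact hcop.neg_left.add_mul_left_left _
  have k₁ : y₁ ^ 2 * (m : ℚ) = 4 * x₁ ^ 2 * (n : ℚ) := by rw [hX, ← hnum]; ring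
  have k₂ : y₂ ^ 2 * (m : ℚ) = 4 * x₂ ^ 2 * ((a ^ 2 * m - n : ℤ) : ℚ) := by
    push_cast; rw [hX', ← hnum]; ring
  -- Up to the positive factor 16x₁², this is the square m²(x₁² - b)².
  have hN : 0 ≤ m ^ 2 - n * (a ^ 2 * m - n) := by
    have key := sq_mul_sq_sub_eq hx₁ e₁ k₁
    have h0 : 0 ≤ 16 * x₁ ^ 2 * ((m : ℚ) ^ 2 - n * (a ^ 2 * m - n)) := by
      rw [← key]; positivity
    exact_mod_cast nonneg_of_mul_nonneg_right h0 (by positivity)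
  rw [scaledHeight_of_isCoprime ha (hasXCoord_two_smul_of_isogeny h₁ hx₁ hm.ne' k₁)
      (isCoprime_isogeny hcop),
    scaledHeight_of_isCoprime ha (hasXCoord_two_smul_of_isogeny h₂ hx₂ hm.ne' k₂)
      (isCoprime_isogeny hcop')]
  have p₁ := one_le_max_of_isCoprime ha (isCoprime_isogeny (a := a) hcop)
  have p₂ := one_le_max_of_isCoprime ha (isCoprime_isogeny (a := a) hcop')
  have haR : (a : ℝ) ≠ 0 := mod_cast ha
  rw [← Real.log_mul (by positivity) (by linarith)]
  refine Real.log_le_log (by linarith) ?_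
  have main := max_isogeny_le (A := (a : ℝ) ^ 2) (m := m) (n := n) (n' := (a : ℝ) ^ 2 * m - n)
    (one_le_sq_cast ha) (by exact_mod_cast hm) (by exact_mod_cast hn) (by exact_mod_cast hn')
    (by ring) (by exact_mod_cast hN)
  push_cast
  have c₁ : (a : ℝ) ^ 2 * m - ((a : ℝ) ^ 2 * m - n) = n := by ring
  rw [c₁, mul_comm ((a : ℝ) ^ 2 * m - n) (n : ℝ)]
  convert main using 2
  ring

/-! ### Conclusion for the two maps. -/

theorem canonicalHeight_sub_le {a : ℤ} (ha : a ≠ 0) {x₁ y₁ x₂ y₂ : ℚ}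
    (h₁ : (E a).Nonsingular x₁ y₁) (h₂ : (E a).Nonsingular x₂ y₂)
    (hx : x₁ * x₂ = -((a : ℚ) ^ 4 - 4)) :
    canonicalHeight (WeierstrassCurve.Affine.Point.some x₁ y₁ h₁)
      - canonicalHeight (WeierstrassCurve.Affine.Point.some x₂ y₂ h₂)
      ≤ 51.18 + 2 * Real.log |(a : ℝ)| := by
  have t := scaledHeight_two_smul_le ha h₁ h₂ hx
  have u₁ := (canonicalHeight_sub_scaledHeight ha _
    (xNum_two_smul_nonneg (WeierstrassCurve.Affine.Point.some x₁ y₁ h₁))).1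
  have u₂ := (canonicalHeight_sub_scaledHeight ha _
    (xNum_two_smul_nonneg (WeierstrassCurve.Affine.Point.some x₂ y₂ h₂))).2
  rw [canonicalHeight_two_smul] at u₁ u₂
  have haR : (a : ℝ) ≠ 0 := mod_cast ha
  have hl : 0 ≤ Real.log |(a : ℝ)| := Real.log_nonneg (by exact_mod_cast Int.one_le_abs ha)
  rw [Real.log_mul (by norm_num) (by positivity), Real.log_pow, ← Real.log_abs (a : ℝ)] at t u₂
  have l1 := Real.log_le_sub_one_of_pos (show (0 : ℝ) < 2 by norm_num)
  have l2 := Real.log_le_sub_one_of_pos (show (0 : ℝ) < 24 by norm_num)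
  have l3 : Real.log 2304 ≤ 94 := by
    have e : (2304 : ℝ) = 48 ^ 2 := by norm_num
    have := Real.log_le_sub_one_of_pos (show (0 : ℝ) < 48 by norm_num)
    rw [e, Real.log_pow]
    push_cast
    linarith
  push_cast at t u₂
  -- The coefficient of log|a| is (4 + 8/3)/4 = 5/3 ≤ 2. Even with log t ≤ t - 1, the constant is at
  -- most (1 + (94 + 23)/3)/4 = 10, well below 51.18.
  linarith

/-- With q = a²(X⁴ - 6X²Z² + Z⁴), the numerators are (X² + Z²)(∓q - 2Y), and the equation of C_a
says exactly 4Y² - q² = -(a⁴ - 4)(X² + Z²)⁴. -/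
theorem phi1X_mul_phi2X {a : ℤ} (p : CurveCoords a) :
    phi1X a p.X p.Y p.Z / phiZ p.X p.Z * (phi2X a p.X p.Y p.Z / phiZ p.X p.Z)
      = -((a : ℚ) ^ 4 - 4) := by
  have hd := phiZ_ne p
  have h := p.equation
  unfold octic at h
  field_simp
  unfold phi1X phi2X phiZ
  linear_combination (4 * (p.X ^ 2 + p.Z ^ 2) ^ 2) * h

end DemyanenkoManin

theorem mainTheorem4 (a : ℤ) (ha : a ≠ 0) (P : DemyanenkoManin.Curve a) :
    |DemyanenkoManin.canonicalHeight (DemyanenkoManin.phi1 P)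
        - DemyanenkoManin.canonicalHeight (DemyanenkoManin.phi2 P)|
      ≤ 51.18 + 2 * Real.log |(a : ℝ)| := by
  induction P using Quotient.inductionOn with
  | h p =>
    have hx := DemyanenkoManin.phi1X_mul_phi2X p
    rw [abs_sub_le_iff]
    exact ⟨DemyanenkoManin.canonicalHeight_sub_le ha _ _ hx,
      DemyanenkoManin.canonicalHeight_sub_le ha _ _ (by rw [mul_comm]; exact hx)⟩
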